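/- Let $L>0$, $T>0$, $0<\alpha\le 1$, $0<\gamma\le 1$, $\underline a>0$, $\overline a\in\mathbb R$ and $K\ge 0$. There is a constant $C>0$, depending only on $L,T,\alpha,\gamma,\underline a,\overline a,K$, such that the following holds. Let $a,w_0:\mathbb R\to\mathbb R$ be $L$-periodic with $\underline a\le a(x)\le\overline a$, $|a(x)-a(y)|\le K|x-y|^{\alpha}$ and $|w_0(x)-w_0(y)|\le M|x-y|^{\gamma}$ for all $x,y$, where $M\ge 0$; write $D=[0,L)$. Let $\rho\in C^\infty(\mathbb R)$ be even with $0\le\rho\le 1$, $\rho(x)=0$ for $|x|\ge 1$ and $\int_{\mathbb R}\rho=1$, and put $\rho_\delta(x)=\delta^{-1}\rho(x/\delta)$. 1. For every $\delta>0$ the problem $$\partial_t\Big(\frac{w^\delta}{a*\rho_\delta}\Big)+\partial_x w^\delta=0,\qquad w^\delta(0,\cdot)=w_0*\rho_\delta,$$ has a classical solution, $C^1$ on $[0,T]\times\mathbb R$ and $L$-periodic in $x$, and as $\delta\to0^+$ the solutions $w^\delta$ converge, uniformly on $[0,T]\times\mathbb R$, to a function $w$. This $w$ is a weak solution of $\partial_t(w/a)+\partial_x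 w=0$, $w(0,\cdot)=w_0$, i.e. it is $L$-periodic in $x$, Hölder continuous on $[0,T]\times\mathbb R$ with some positive exponent, and for all $t\in[0,T]$ and all smooth $\varphi(s,x)$ that are $L$-periodic in $x$, $$\int_0^t\!\!\int_D \frac{w}{a}\,\partial_s\varphi\,dx\,ds+\int_0^t\!\!\int_D w\,\partial_x\varphi\,dx\,ds+\int_D\frac{w_0}{a}\varphi(0,x)\,dx=\int_D\frac{w(t,x)}{a}\varphi(t,x)\,dx .$$ 2. For $\theta>0$ with $\theta\le 1/\overline a$ and an integer $N\ge1$ put $\Delta x=L/N$ and $\Delta t=\theta\Delta x$. For $j\in\mathbb Z$ let $a_j$ and $w_j^0$ be the averages of $a$ and $w_0$ over the cell $[(j-1)\Delta x,j\Delta x)$, let $w_j^n$ ($n\ge 0$) be defined by the upwind scheme $$\frac{1}{a_j}\,\frac{w_j^{n+1}-w_j^n}{\Delta t}=-\frac{w_j^n-w_{j-1}^n}{\Delta x},$$ and put $w_{\Delta x}(t,x)=w_j^n$ for $(t,x)\in[n\Delta t,(n+1)\Delta t)\times[(j-1)\Delta x,j\Delta x)$. Then for all such $\theta$ and $N$ and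 all $0<t<T$, $$\|(w-w_{\Delta x})(t,\cdot)\|_{L^1(D)}\le C\,M\,\Delta x^{\gamma\alpha/(\gamma\alpha+2-\gamma)}+C\,\|w_0-w_{\Delta x}(0,\cdot)\|_{L^1(D)},$$ and for fixed $\theta$ and $t$ one has $w_{\Delta x}(t,\cdot)\to w(t,\cdot)$ in $L^1(D)$ as $\Delta x=L/N\to0$. -/

import Mathlib

open Set Filter Topology MeasureTheory
open scoped NNReal ContDiff

namespace Upwind

/-- The mollifying kernel `ρ`: smooth, even, `0 ≤ ρ ≤ 1`, vanishing for `|x| ≥ 1`, of integral one. -/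
structure IsMollifier (ρ : ℝ → ℝ) : Prop where
  contDiff : ContDiff ℝ ∞ ρ
  even : ∀ x, ρ (-x) = ρ x
  nonneg : ∀ x, 0 ≤ ρ x
  le_one : ∀ x, ρ x ≤ 1
  eq_zero : ∀ x, 1 ≤ |x| → ρ x = 0
  integral_eq_one : ∫ x, ρ x = 1

/-- The convolution `f ∗ ρ_δ`, where `ρ_δ(x) = ρ(x / δ) / δ`, i.e.
`x ↦ ∫ y, f y * ρ_δ (x - y)`. -/
noncomputable def mollify (ρ : ℝ → ℝ) (δ : ℝ) (f : ℝ → ℝ) : ℝ → ℝ :=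
  convolution f (fun x => 1 / δ * ρ (x / δ)) (ContinuousLinearMap.mul ℝ ℝ) volume

/-- `v` is an `L`-periodic (in space) classical solution of `∂ₜ(v / b) + ∂ₓ v = 0` on the time
interval `[0, T]` with `v(0, ·) = v₀`. As `v` is `C¹` on the closed strip, the equation extends
to `t = 0` and `t = T` by continuity. The values `v t` for `t ∉ [0, T]` are irrelevant. -/
structure IsClassicalSolution (L T : ℝ) (b v₀ : ℝ → ℝ) (v : ℝ → ℝ → ℝ) : Prop where
  periodic : ∀ t ∈ Icc 0 T, Function.Periodic (v t) L
  contDiffOn : ContDiffOn ℝ 1 (Function.uncurry v) (Icc 0 T ×ˢ univ)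
  initial : ∀ x, v 0 x = v₀ x
  equation : ∀ t ∈ Ioo 0 T, ∀ x,
    deriv (fun s => v s x / b x) t + deriv (fun y => v t y) x = 0

/-- `w` is the limit as `δ → 0+` of the solutions `w^δ` of the problem with mollified coefficient
`a ∗ ρ_δ` and mollified initial datum `w₀ ∗ ρ_δ`: these problems are solvable for all `δ > 0`, and
their solutions converge to `w`, uniformly on `[0, T] × ℝ`. -/
structure IsRegularizationLimit (L T : ℝ) (ρ a w₀ : ℝ → ℝ) (w : ℝ → ℝ → ℝ) : Prop where
  exists_solution : ∀ δ > 0, ∃ v : ℝ → ℝ → ℝ,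
    IsClassicalSolution L T (mollify ρ δ a) (mollify ρ δ w₀) v
  tendsto : ∀ v : ℝ → ℝ → ℝ → ℝ,
    (∀ δ > 0, IsClassicalSolution L T (mollify ρ δ a) (mollify ρ δ w₀) (v δ)) →
    TendstoUniformlyOn (fun δ => Function.uncurry (v δ)) (Function.uncurry w) (𝓝[>] 0)
      (Icc 0 T ×ˢ univ)

/-- `w` is an `L`-periodic (in space) Hölder continuous weak solution on `[0, T]` of
`∂ₜ(w / a) + ∂ₓ w = 0`, `w(0, ·) = w₀`, tested with smooth functions that are `L`-periodic in
space. -/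
structure IsWeakSolution (L T : ℝ) (a w₀ : ℝ → ℝ) (w : ℝ → ℝ → ℝ) : Prop where
  periodic : ∀ t ∈ Icc 0 T, Function.Periodic (w t) L
  holder : ∃ β : ℝ≥0, 0 < β ∧ ∃ H : ℝ≥0,
    HolderOnWith H β (Function.uncurry w) (Icc 0 T ×ˢ univ)
  weak : ∀ φ : ℝ → ℝ → ℝ, ContDiff ℝ ∞ (Function.uncurry φ) →
    (∀ t, Function.Periodic (φ t) L) → ∀ t ∈ Icc 0 T,
    (∫ s in 0..t, ∫ x in 0..L, w s x / a x * deriv (fun r => φ r x) s)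
      + (∫ s in 0..t, ∫ x in 0..L, w s x * deriv (fun y => φ s y) x)
      + (∫ x in 0..L, w₀ x / a x * φ 0 x)
      = ∫ x in 0..L, w t x / a x * φ t x

/-- The average of `f` over the cell `[x_{j-1/2}, x_{j+1/2}) = [(j - 1) h, j h)`. -/
noncomputable def cellAverage (h : ℝ) (f : ℝ → ℝ) (j : ℤ) : ℝ :=
  1 / h * ∫ x in (((j : ℝ) - 1) * h)..((j : ℝ) * h), f x

/-- The forward difference quotient in time, with step `k`. -/
noncomputable def fwdDiffTime (k : ℝ) (W : ℕ → ℤ → ℝ) (n : ℕ) (j : ℤ) : ℝ :=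
  1 / k * (W (n + 1) j - W n j)

/-- The backward difference quotient in space, with step `h`. -/
noncomputable def bwdDiffSpace (h : ℝ) (W : ℕ → ℤ → ℝ) (n : ℕ) (j : ℤ) : ℝ :=
  -(1 / h) * (W n (j - 1) - W n j)

/-- The values `w_j^n` of the upwind scheme with mesh size `h` and time step `k`, solved for the new time
level; `eq_upwindScheme_iff` states the scheme through its difference quotients. For periodic data
the cells are indexed by all integers `j`. -/
noncomputable def upwindScheme (h k : ℝ) (a w₀ : ℝ → ℝ) : ℕ → ℤ → ℝ
  | 0, j => cellAverage h w₀ j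
  | n + 1, j => upwindScheme h k a w₀ n j
      - k / h * cellAverage h a j * (upwindScheme h k a w₀ n j - upwindScheme h k a w₀ n (j - 1))

/-- The scheme is `D⁺ₜ w_j^n / a_j = - D⁻ₓ w_j^n`, started from the cell averages of `w₀`. -/
theorem eq_upwindScheme_iff {h k : ℝ} (hk : k ≠ 0) {a w₀ : ℝ → ℝ}
    (ha : ∀ j, cellAverage h a j ≠ 0) (W : ℕ → ℤ → ℝ) :
    W = upwindScheme h k a w₀ ↔
      (∀ j, W 0 j = cellAverage h w₀ j) ∧
      ∀ n j, fwdDiffTime k W n j / cellAverage h a j = -bwdDiffSpace h W n j := by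
  have key : ∀ n j, (fwdDiffTime k W n j / cellAverage h a j = -bwdDiffSpace h W n j ↔
      W (n + 1) j = W n j - k / h * cellAverage h a j * (W n j - W n (j - 1))) := by
    intro n j
    have h1 := ha j
    unfold fwdDiffTime bwdDiffSpace
    rw [div_eq_iff h1, one_div, inv_mul_eq_iff_eq_mul₀ hk]
    constructor
    · intro e
      linear_combination e
    · intro e
      linear_combination e
  constructor
  · rintro rfl
    refine ⟨fun j => by simp [upwindScheme], fun n j => (key n j).2 ?_⟩
    rw [upwindScheme]
  · rintro ⟨h0, hs⟩
    funext n
    induction n with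
    | zero => funext j; rw [h0, upwindScheme]
    | succ n ih => funext j; rw [(key n j).1 (hs n j), ih, upwindScheme]

/-- The piecewise constant approximation: `w_Δx(t, x) = w_j^n` for
`(t, x) ∈ [n k, (n + 1) k) × [(j - 1) h, j h)`. -/
noncomputable def approx (h k : ℝ) (a w₀ : ℝ → ℝ) (t x : ℝ) : ℝ :=
  upwindScheme h k a w₀ ⌊t / k⌋₊ (⌊x / h⌋ + 1)

end Upwind

/-! In one space dimension the characteristics come from separating variables. With `A(x) = ∫₀ˣ 1/a`
(`travelTime`) and its inverse `B` (`position`), the solution is `w(t,x) = w₀(B(A(x) - t))`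
(`transport`). No regularity of `a` beyond continuity and positive bounds enters: `A` and `B` are
Lipschitz, and a uniform perturbation of size `η` in the velocity moves the foot of a characteristic
by `O(η)`. Hence the mollified solutions, which are constant along their characteristics, converge
uniformly. The substitution `x = B(z + s)` makes `w` independent of `s` and reduces the weak
formulation to the fundamental theorem of calculus.

For the error, the upwind step is a convex combination under the CFL condition. Thus `w_j^n` is the
mean of the initial cell averages over a random walk that jumps from cell `j` to `j - 1` with
probability `k a_j / h`. Measured by the travel time of the cell-averaged velocity, that jump has
length `h / a_j`, so each step has mean exactly `k` and variance at most `k h / l`, where `l` is the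
lower bound of `a` (`abs_upwindScheme_sub_le`). The mean square deviation from the true foot is
therefore `O(h^{2α} + h)`. A Hölder modulus `r^γ` is dominated by `ε^γ (1 + r²/ε²)`, and `ε = h^β`
with `β ≤ α`, `2β ≤ 1` gives the uniform error `O(M h^{γβ})`. The claimed rate is the case `β = α /
(γα + 2 - γ)`, and integration over a period gives the `L¹` bound. -/

namespace Upwind

/-! ### Travel times -/

/-- The time a particle of velocity `b` needs to get from `0` to `x`. -/
noncomputable def travelTime (b : ℝ → ℝ) (x : ℝ) : ℝ := ∫ y in 0..x, 1 / b y

/-- The position at time `z` of a particle of velocity `b` that starts at `0`. -/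
noncomputable def position (b : ℝ → ℝ) : ℝ → ℝ := Function.invFun (travelTime b)

/-- The solution of `∂ₜ(v / b) + ∂ₓ v = 0`, `v(0, ·) = v₀` given by the characteristics. -/
noncomputable def transport (b v₀ : ℝ → ℝ) (t x : ℝ) : ℝ := v₀ (position b (travelTime b x - t))

section Measurable

variable {b : ℝ → ℝ} {l u : ℝ}

/-- Measurability suffices in this section, so that its estimates also cover the discontinuous
velocity `cellStep`. -/
theorem intervalIntegrable_one_div (hb : Measurable b) (hl : 0 < l) (h : ∀ x, l ≤ b x) (x y : ℝ) :
    IntervalIntegrable (fun z => 1 / b z) volume x y := by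
  refine (intervalIntegrable_const (c := 1 / l)).mono_fun
    (measurable_const.div hb).aestronglyMeasurable (Eventually.of_forall fun z => ?_)
  have hz := hl.trans_le (h z)
  change ‖1 / b z‖ ≤ ‖1 / l‖
  rw [Real.norm_of_nonneg (by positivity), Real.norm_of_nonneg (by positivity)]
  exact one_div_le_one_div_of_le hl (h z)

theorem travelTime_sub (hb : Measurable b) (hl : 0 < l) (h : ∀ x, l ≤ b x) (x y : ℝ) :
    travelTime b y - travelTime b x = ∫ z in x..y, 1 / b z :=
  intervalIntegral.integral_interval_sub_left (intervalIntegrable_one_div hb hl h _ _)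
    (intervalIntegrable_one_div hb hl h _ _)

theorem abs_travelTime_sub_le (hb : Measurable b) (hl : 0 < l) (h : ∀ x, l ≤ b x) (x y : ℝ) :
    |travelTime b y - travelTime b x| ≤ |y - x| / l := by
  rw [travelTime_sub hb hl h, ← Real.norm_eq_abs]
  refine (intervalIntegral.norm_integral_le_of_norm_le_const (C := 1 / l) fun z _ => ?_).trans_eq
    (by ring)
  have hz := hl.trans_le (h z)
  rw [Real.norm_of_nonneg (by positivity)]
  exact one_div_le_one_div_of_le hl (h z)

theorem sub_div_le_travelTime_sub (hb : Measurable b) (hl : 0 < l) (h : ∀ x, l ≤ b x ∧ b x ≤ u)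
    {x y : ℝ} (hxy : x ≤ y) : (y - x) / u ≤ travelTime b y - travelTime b x := by
  rw [travelTime_sub hb hl fun z => (h z).1]
  have := intervalIntegral.integral_mono_on hxy (intervalIntegrable_const (c := 1 / u))
    (intervalIntegrable_one_div hb hl (fun z => (h z).1) x y) fun z _ =>
      one_div_le_one_div_of_le (hl.trans_le (h z).1) (h z).2
  refine le_trans (le_of_eq ?_) this
  rw [intervalIntegral.integral_const, smul_eq_mul]
  ring

theorem abs_sub_le_travelTime (hb : Measurable b) (hl : 0 < l) (h : ∀ x, l ≤ b x ∧ b x ≤ u)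
    (x y : ℝ) : |y - x| ≤ u * |travelTime b y - travelTime b x| := by
  have hu : 0 < u := hl.trans_le ((h 0).1.trans (h 0).2)
  wlog hxy : x ≤ y generalizing x y
  · rw [abs_sub_comm, abs_sub_comm (travelTime b y)]
    exact this y x (le_of_not_ge hxy)
  have h1 := sub_div_le_travelTime_sub hb hl h hxy
  rw [abs_of_nonneg (sub_nonneg.2 hxy)]
  rw [div_le_iff₀ hu, mul_comm] at h1
  exact h1.trans (mul_le_mul_of_nonneg_left (le_abs_self _) hu.le)

/-- Travel times depend Lipschitz continuously on the velocity. -/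
theorem abs_travelTime_sub_sub_le {c : ℝ → ℝ} {η : ℝ} (hb : Measurable b) (hc : Measurable c)
    (hl : 0 < l) (h : ∀ x, l ≤ b x) (h' : ∀ x, l ≤ c x) (hη : ∀ x, |b x - c x| ≤ η) (x y : ℝ) :
    |(travelTime c y - travelTime c x) - (travelTime b y - travelTime b x)|
      ≤ η / l ^ 2 * |y - x| := by
  rw [travelTime_sub hb hl h, travelTime_sub hc hl h', ← intervalIntegral.integral_sub
    (intervalIntegrable_one_div hc hl h' _ _) (intervalIntegrable_one_div hb hl h _ _),
    ← Real.norm_eq_abs]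
  refine intervalIntegral.norm_integral_le_of_norm_le_const fun z _ => ?_
  have hbz := hl.trans_le (h z)
  have hcz := hl.trans_le (h' z)
  rw [Real.norm_eq_abs, div_sub_div _ _ hcz.ne' hbz.ne', abs_div, one_mul, mul_one,
    abs_of_pos (mul_pos hcz hbz)]
  have : l ^ 2 ≤ c z * b z := by nlinarith [h z, h' z]
  exact div_le_div₀ ((abs_nonneg _).trans (hη z)) (hη z) (by positivity) this

end Measurable

section Continuous

variable {b : ℝ → ℝ} {l u : ℝ}

theorem hasDerivAt_travelTime (hb : Continuous b) (hl : 0 < l) (h : ∀ x, l ≤ b x) (x : ℝ) :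
    HasDerivAt (travelTime b) (1 / b x) x := by
  have hc : Continuous fun z => 1 / b z :=
    continuous_const.div hb fun z => (hl.trans_le (h z)).ne'
  exact intervalIntegral.integral_hasDerivAt_right (hc.intervalIntegrable _ _)
    hc.aestronglyMeasurable.stronglyMeasurableAtFilter hc.continuousAt

theorem continuous_travelTime (hb : Continuous b) (hl : 0 < l) (h : ∀ x, l ≤ b x) :
    Continuous (travelTime b) :=
  continuous_iff_continuousAt.2 fun x => (hasDerivAt_travelTime hb hl h x).continuousAt

theorem bijective_travelTime (hb : Continuous b) (hl : 0 < l) (h : ∀ x, l ≤ b x ∧ b x ≤ u) :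
    Function.Bijective (travelTime b) := by
  have hu : 0 < u := hl.trans_le ((h 0).1.trans (h 0).2)
  have h0 : travelTime b 0 = 0 := by simp [travelTime]
  refine ⟨fun x y hxy => ?_, (continuous_travelTime hb hl fun x => (h x).1).surjective ?_ ?_⟩
  · have := abs_sub_le_travelTime hb.measurable hl h y x
    rw [hxy, sub_self, abs_zero, mul_zero] at this
    exact sub_eq_zero.1 (abs_nonpos_iff.1 this)
  · refine tendsto_atTop_mono' _ ?_ (tendsto_id.atTop_div_const hu)
    filter_upwards [eventually_ge_atTop 0] with x hx
    simpa [h0] using sub_div_le_travelTime_sub hb.measurable hl h hx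
  · refine tendsto_atBot_mono' _ ?_ (tendsto_id.atBot_div_const hu)
    filter_upwards [eventually_le_atBot 0] with x hx
    have := sub_div_le_travelTime_sub hb.measurable hl h hx
    simp only [h0, id] at this ⊢
    rw [zero_sub, neg_div] at this
    linarith

theorem position_travelTime (hb : Continuous b) (hl : 0 < l) (h : ∀ x, l ≤ b x ∧ b x ≤ u) (x : ℝ) :
    position b (travelTime b x) = x :=
  Function.leftInverse_invFun (bijective_travelTime hb hl h).1 x

theorem travelTime_position (hb : Continuous b) (hl : 0 < l) (h : ∀ x, l ≤ b x ∧ b x ≤ u) (z : ℝ) :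
    travelTime b (position b z) = z :=
  Function.rightInverse_invFun (bijective_travelTime hb hl h).2 z

theorem abs_position_sub_le (hb : Continuous b) (hl : 0 < l) (h : ∀ x, l ≤ b x ∧ b x ≤ u)
    (y z : ℝ) : |position b z - position b y| ≤ u * |z - y| := by
  simpa only [travelTime_position hb hl h] using
    abs_sub_le_travelTime hb.measurable hl h (position b y) (position b z)

theorem continuous_position (hb : Continuous b) (hl : 0 < l) (h : ∀ x, l ≤ b x ∧ b x ≤ u) :
    Continuous (position b) := by
  have hu : 0 < u := hl.trans_le ((h 0).1.trans (h 0).2)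
  exact (LipschitzWith.of_dist_le_mul (K := u.toNNReal) fun z y => by
    simpa [Real.dist_eq, Real.coe_toNNReal u hu.le] using
      abs_position_sub_le hb hl h y z).continuous

/-- The inverse function rule solves the autonomous equation `B' = b(B)` for velocities that need
not be Lipschitz. -/
theorem hasDerivAt_position (hb : Continuous b) (hl : 0 < l) (h : ∀ x, l ≤ b x ∧ b x ≤ u) (z : ℝ) :
    HasDerivAt (position b) (b (position b z)) z := by
  have hz : b (position b z) ≠ 0 := (hl.trans_le (h _).1).ne'
  have := (hasDerivAt_travelTime hb hl (fun x => (h x).1) (position b z)).of_local_left_inverse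
    (continuous_position hb hl h).continuousAt (one_div_ne_zero hz)
    (Eventually.of_forall (travelTime_position hb hl h))
  simpa using this

theorem travelTime_add_period {L : ℝ} (hb : Continuous b) (hl : 0 < l) (h : ∀ x, l ≤ b x)
    (hp : Function.Periodic b L) (x : ℝ) :
    travelTime b (x + L) = travelTime b x + travelTime b L := by
  have hq : Function.Periodic (fun z => 1 / b z) L := fun z => by simp only [hp z]
  have h1 := travelTime_sub hb.measurable hl h x (x + L)
  rw [hq.intervalIntegral_add_eq x 0, zero_add] at h1
  rw [← sub_eq_iff_eq_add', h1, travelTime]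

theorem position_add_period {L : ℝ} (hb : Continuous b) (hl : 0 < l)
    (h : ∀ x, l ≤ b x ∧ b x ≤ u) (hp : Function.Periodic b L) (z : ℝ) :
    position b (z + travelTime b L) = position b z + L := by
  apply (bijective_travelTime hb hl h).1
  rw [travelTime_position hb hl h, travelTime_add_period hb hl (fun x => (h x).1) hp,
    travelTime_position hb hl h]

/-- The substitution `x = position b (z + s)` in an integral over a period. -/
theorem integral_div_eq_integral_position {L : ℝ} {G : ℝ → ℝ} (hb : Continuous b) (hl : 0 < l)
    (h : ∀ x, l ≤ b x ∧ b x ≤ u) (hp : Function.Periodic b L) (hG : Continuous G)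
    (hGp : Function.Periodic G L) (s : ℝ) :
    ∫ x in 0..L, G x / b x = ∫ z in 0..travelTime b L, G (position b (z + s)) := by
  have hbne : ∀ x, b x ≠ 0 := fun x => (hl.trans_le (h x).1).ne'
  have h1 := intervalIntegral.integral_comp_mul_deriv (a := 0) (b := L)
    (g := fun z => G (position b z))
    (fun x _ => hasDerivAt_travelTime hb hl (fun x => (h x).1) x)
    (continuous_const.div hb hbne).continuousOn (hG.comp (continuous_position hb hl h))
  have h0 : travelTime b 0 = 0 := by simp [travelTime]
  have hper : Function.Periodic (fun z => G (position b z)) (travelTime b L) := fun z => by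
    simp only [position_add_period hb hl h hp, hGp _]
  rw [intervalIntegral.integral_comp_add_right (fun z => G (position b z)), zero_add,
    add_comm (travelTime b L), hper.intervalIntegral_add_eq s 0, zero_add]
  rw [h0] at h1
  rw [← h1]
  refine intervalIntegral.integral_congr fun x _ => ?_
  simp only [Function.comp, position_travelTime hb hl h]
  ring

end Continuous

/-! ### Mollification -/

section Mollify

variable {ρ f : ℝ → ℝ} {δ : ℝ}

theorem IsMollifier.hasCompactSupport_rescale (hρ : IsMollifier ρ) (hδ : 0 < δ) :
    HasCompactSupport fun x => 1 / δ * ρ (x / δ) := by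
  refine HasCompactSupport.intro (isCompact_Icc (a := -δ) (b := δ)) fun x hx => ?_
  rw [hρ.eq_zero, mul_zero]
  rw [abs_div, abs_of_pos hδ, one_le_div hδ]
  by_contra! h
  exact hx (abs_le.1 h.le)

theorem IsMollifier.contDiff_rescale (hρ : IsMollifier ρ) :
    ContDiff ℝ ∞ fun x => 1 / δ * ρ (x / δ) :=
  contDiff_const.mul (hρ.contDiff.comp (contDiff_id.div_const δ))

theorem IsMollifier.integral_rescale (hρ : IsMollifier ρ) (hδ : 0 < δ) :
    ∫ x, 1 / δ * ρ (x / δ) = 1 := by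
  rw [integral_const_mul, Measure.integral_comp_div ρ δ, hρ.integral_eq_one, abs_of_pos hδ]
  simp [hδ.ne']

theorem contDiff_mollify (hρ : IsMollifier ρ) (hδ : 0 < δ) (hf : Continuous f) :
    ContDiff ℝ ∞ (mollify ρ δ f) :=
  (hρ.hasCompactSupport_rescale hδ).contDiff_convolution_right _ hf.locallyIntegrable
    hρ.contDiff_rescale

theorem mollify_apply (x : ℝ) :
    mollify ρ δ f x = ∫ y, f (x - y) * (1 / δ * ρ (y / δ)) := by
  rw [mollify, convolution_eq_swap]
  rfl

theorem integrable_mollify_integrand (hρ : IsMollifier ρ) (hδ : 0 < δ) (hf : Continuous f) (x : ℝ) :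
    Integrable fun y => f (x - y) * (1 / δ * ρ (y / δ)) :=
  ((hf.comp (continuous_const.sub continuous_id)).mul
    hρ.contDiff_rescale.continuous).integrable_of_hasCompactSupport
      (hρ.hasCompactSupport_rescale hδ).mul_left

theorem mollify_periodic {L : ℝ} (hf : Function.Periodic f L) :
    Function.Periodic (mollify ρ δ f) L := fun x => by
  simp only [mollify_apply, add_sub_right_comm, hf _]

/-- A mollification at scale `δ` takes its values in every interval that contains the values of
the function at distance less than `δ`. -/
theorem mollify_mem_Icc (hρ : IsMollifier ρ) (hδ : 0 < δ) (hf : Continuous f) {l u x : ℝ}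
    (h : ∀ y, |y| < δ → f (x - y) ∈ Icc l u) : mollify ρ δ f x ∈ Icc l u := by
  have hint : Integrable (fun y => 1 / δ * ρ (y / δ)) :=
    hρ.contDiff_rescale.continuous.integrable_of_hasCompactSupport
      (hρ.hasCompactSupport_rescale hδ)
  have key : ∀ y, l * (1 / δ * ρ (y / δ)) ≤ f (x - y) * (1 / δ * ρ (y / δ)) ∧
      f (x - y) * (1 / δ * ρ (y / δ)) ≤ u * (1 / δ * ρ (y / δ)) := fun y => by
    rcases lt_or_ge |y| δ with hy | hy
    · have := mul_nonneg (one_div_nonneg.2 hδ.le) (hρ.nonneg (y / δ))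
      exact ⟨mul_le_mul_of_nonneg_right (h y hy).1 this,
        mul_le_mul_of_nonneg_right (h y hy).2 this⟩
    · rw [hρ.eq_zero (y / δ) (by rwa [abs_div, abs_of_pos hδ, one_le_div hδ])]
      simp
  have h1 := integral_mono (hint.const_mul l) (integrable_mollify_integrand hρ hδ hf x)
    fun y => (key y).1
  have h2 := integral_mono (integrable_mollify_integrand hρ hδ hf x) (hint.const_mul u)
    fun y => (key y).2
  rw [integral_const_mul, hρ.integral_rescale hδ, mul_one] at h1 h2
  rw [mollify_apply]
  exact ⟨h1, h2⟩

theorem holderWith_abs_sub_le {K α : ℝ≥0} (hf : HolderWith K α f) {x y d : ℝ} (h : |x - y| ≤ d) :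
    |f x - f y| ≤ K * d ^ (α : ℝ) := by
  simpa [Real.dist_eq] using hf.dist_le_of_le (x := x) (y := y) (d := d) (by rwa [Real.dist_eq])

theorem abs_mollify_sub_le (hρ : IsMollifier ρ) (hδ : 0 < δ) {K α : ℝ≥0} (hα : 0 < α)
    (hf : HolderWith K α f) (x : ℝ) : |f x - mollify ρ δ f x| ≤ K * δ ^ (α : ℝ) := by
  have := mollify_mem_Icc hρ hδ (hf.continuous hα) (l := f x - K * δ ^ (α : ℝ))
    (u := f x + K * δ ^ (α : ℝ)) (x := x) fun y hy => by
      have := abs_le.1 (holderWith_abs_sub_le hf (x := x - y) (y := x) (d := δ)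
        (by simpa using hy.le))
      constructor <;> linarith [this.1, this.2]
  rw [abs_le]
  constructor <;> linarith [this.1, this.2]

end Mollify

/-! ### Classical solutions -/

section Transport

variable {b v₀ : ℝ → ℝ} {l u : ℝ}

theorem transport_position (hb : Continuous b) (hl : 0 < l) (h : ∀ x, l ≤ b x ∧ b x ≤ u)
    (t z : ℝ) : transport b v₀ t (position b (z + t)) = v₀ (position b z) := by
  rw [transport, travelTime_position hb hl h, add_sub_cancel_right]

theorem continuous_transport (hb : Continuous b) (hl : 0 < l) (h : ∀ x, l ≤ b x ∧ b x ≤ u)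
    (hv : Continuous v₀) : Continuous (Function.uncurry (transport b v₀)) :=
  hv.comp ((continuous_position hb hl h).comp
    (((continuous_travelTime hb hl fun x => (h x).1).comp continuous_snd).sub continuous_fst))

theorem transport_periodic {L : ℝ} (hb : Continuous b) (hl : 0 < l) (h : ∀ x, l ≤ b x ∧ b x ≤ u)
    (hbp : Function.Periodic b L) (hv : Function.Periodic v₀ L) (t : ℝ) :
    Function.Periodic (transport b v₀ t) L := fun x => by
  rw [transport, travelTime_add_period hb hl (fun x => (h x).1) hbp, add_sub_right_comm,
    position_add_period hb hl h hbp, hv, transport]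

theorem transport_zero (hb : Continuous b) (hl : 0 < l) (h : ∀ x, l ≤ b x ∧ b x ≤ u) (x : ℝ) :
    transport b v₀ 0 x = v₀ x := by
  rw [transport, sub_zero, position_travelTime hb hl h]

theorem contDiff_position (hb : Continuous b) (hl : 0 < l) (h : ∀ x, l ≤ b x ∧ b x ≤ u) :
    ContDiff ℝ 1 (position b) := by
  refine contDiff_one_iff_deriv.2
    ⟨fun z => (hasDerivAt_position hb hl h z).differentiableAt, ?_⟩
  rw [funext fun z => (hasDerivAt_position hb hl h z).deriv]
  exact hb.comp (continuous_position hb hl h)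

theorem contDiff_travelTime (hb : Continuous b) (hl : 0 < l) (h : ∀ x, l ≤ b x) :
    ContDiff ℝ 1 (travelTime b) := by
  refine contDiff_one_iff_deriv.2
    ⟨fun z => (hasDerivAt_travelTime hb hl h z).differentiableAt, ?_⟩
  rw [funext fun z => (hasDerivAt_travelTime hb hl h z).deriv]
  exact continuous_const.div hb fun z => (hl.trans_le (h z)).ne'

/-- The solution is `g(A(x) - t)` with `g = v₀ ∘ B`, and `A' = 1/b` makes the two terms of the
equation cancel. -/
theorem isClassicalSolution_transport {L T : ℝ} (hb : Continuous b) (hl : 0 < l)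
    (h : ∀ x, l ≤ b x ∧ b x ≤ u) (hbp : Function.Periodic b L) (hv : ContDiff ℝ 1 v₀)
    (hvp : Function.Periodic v₀ L) : IsClassicalSolution L T b v₀ (transport b v₀) where
  periodic t _ := transport_periodic hb hl h hbp hvp t
  contDiffOn := (hv.comp ((contDiff_position hb hl h).comp
    (((contDiff_travelTime hb hl fun x => (h x).1).comp contDiff_snd).sub
      contDiff_fst))).contDiffOn
  initial := transport_zero hb hl h
  equation t _ x := by
    have hbx : b x ≠ 0 := (hl.trans_le (h x).1).ne'
    have hg : ∀ z, HasDerivAt (fun z => v₀ (position b z))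
        (deriv v₀ (position b z) * b (position b z)) z := fun z =>
      ((hv.differentiable one_ne_zero).differentiableAt.hasDerivAt).comp z
        (hasDerivAt_position hb hl h z)
    have h1 : HasDerivAt (fun s => transport b v₀ s x / b x) _ t :=
      (HasDerivAt.comp (h₂ := fun z => v₀ (position b z)) t (hg (travelTime b x - t))
        ((hasDerivAt_id t).const_sub _)).div_const (b x)
    have h2 : HasDerivAt (fun y => transport b v₀ t y) _ x :=
      HasDerivAt.comp (h₂ := fun z => v₀ (position b z)) x (hg (travelTime b x - t))
        ((hasDerivAt_travelTime hb hl (fun x => (h x).1) x).sub_const t)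
    rw [h1.deriv, h2.deriv]
    field_simp
    ring

/-- Classical solutions are constant along characteristics. -/
theorem IsClassicalSolution.eq_transport {L T : ℝ} {v : ℝ → ℝ → ℝ} (hb : Continuous b) (hl : 0 < l)
    (h : ∀ x, l ≤ b x ∧ b x ≤ u) (hv : IsClassicalSolution L T b v₀ v) {t : ℝ} (ht : t ∈ Icc 0 T)
    (x : ℝ) : v t x = transport b v₀ t x := by
  rcases ht.1.eq_or_lt with rfl | ht0
  · rw [hv.initial, transport_zero hb hl h]
  set z := travelTime b x - t with hz
  have hcurve : Continuous fun s => (s, position b (z + s)) :=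
    continuous_id.prodMk ((continuous_position hb hl h).comp (continuous_const.add continuous_id))
  -- The mean value theorem needs the equation only at interior times; continuity on the closed
  -- strip covers the endpoints.
  obtain ⟨c, -, hc⟩ := exists_hasDerivAt_eq_slope (fun s => v s (position b (z + s)))
    (fun _ => 0) ht0
    (hv.contDiffOn.continuousOn.comp hcurve.continuousOn fun s hs =>
      ⟨⟨hs.1, hs.2.trans ht.2⟩, mem_univ _⟩)
    fun s hs => by
      have hsT : s ∈ Ioo 0 T := ⟨hs.1, hs.2.trans_le ht.2⟩
      set y := position b (z + s) with hy
      have hby : b y ≠ 0 := (hl.trans_le (h y).1).ne'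
      have hd : HasFDerivAt (Function.uncurry v) (fderiv ℝ (Function.uncurry v) (s, y)) (s, y) :=
        ((hv.contDiffOn.contDiffAt (prod_mem_nhds (Icc_mem_nhds hsT.1 hsT.2)
          univ_mem)).differentiableAt one_ne_zero).hasFDerivAt
      set F := fderiv ℝ (Function.uncurry v) (s, y)
      have h1 : HasDerivAt (fun r => v r y) (F (1, 0)) s :=
        HasFDerivAt.comp_hasDerivAt (f := fun r => (r, y)) s hd
          ((hasDerivAt_id s).prodMk (hasDerivAt_const s y))
      have h2 : HasDerivAt (fun r => v s r) (F (0, 1)) y :=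
        HasFDerivAt.comp_hasDerivAt (f := fun r => (s, r)) y hd
          ((hasDerivAt_const y s).prodMk (hasDerivAt_id y))
      have h3 : HasDerivAt (fun r => position b (z + r)) (b y) s := by
        simpa using (hasDerivAt_position hb hl h (z + s)).comp_const_add z s
      have h4 : HasDerivAt (fun r => v r (position b (z + r))) (F (1, b y)) s :=
        HasFDerivAt.comp_hasDerivAt (f := fun r => (r, position b (z + r))) s hd
          ((hasDerivAt_id s).prodMk h3)
      have heq := hv.equation s hsT y
      rw [(h1.div_const (b y)).deriv, h2.deriv] at heq
      have hF : F (1, b y) = F (1, 0) + b y * F (0, 1) := by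
        rw [← smul_eq_mul, ← map_smul, ← map_add]
        simp
      have : F (1, b y) = 0 := by
        rw [hF]
        field_simp at heq
        linarith
      rwa [this] at h4
  have h5 : v t (position b (z + t)) = v 0 (position b (z + 0)) := by
    rw [eq_div_iff (by linarith)] at hc
    linarith
  rw [hv.initial, add_zero, hz, sub_add_cancel, position_travelTime hb hl h] at h5
  exact h5

/-- Displacement along a characteristic. -/
theorem abs_sub_position_le (hb : Continuous b) (hl : 0 < l) (h : ∀ x, l ≤ b x ∧ b x ≤ u)
    {t : ℝ} (ht : 0 ≤ t) (x : ℝ) : |x - position b (travelTime b x - t)| ≤ u * t := by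
  have := abs_position_sub_le hb hl h (travelTime b x - t) (travelTime b x)
  rwa [position_travelTime hb hl h, sub_sub_cancel, abs_of_nonneg ht] at this

/-- The feet of the characteristics depend Lipschitz continuously on the velocity. -/
theorem abs_position_sub_position_le {c : ℝ → ℝ} {η : ℝ} (hb : Continuous b) (hc : Continuous c)
    (hl : 0 < l) (h : ∀ x, l ≤ b x ∧ b x ≤ u) (h' : ∀ x, l ≤ c x ∧ c x ≤ u)
    (hη : ∀ x, |b x - c x| ≤ η) {t : ℝ} (ht : 0 ≤ t) (x : ℝ) :
    |position c (travelTime c x - t) - position b (travelTime b x - t)|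
      ≤ u * (η / l ^ 2 * (u * t)) := by
  have hu : 0 < u := hl.trans_le ((h 0).1.trans (h 0).2)
  set y := position c (travelTime c x - t) with hy
  set z := position b (travelTime b x - t) with hz
  have hAy : travelTime c y = travelTime c x - t := travelTime_position hc hl h' _
  have hAz : travelTime b z = travelTime b x - t := travelTime_position hb hl h _
  have h1 := abs_travelTime_sub_sub_le hb.measurable hc.measurable hl (fun x => (h x).1)
    (fun x => (h' x).1) hη y x
  have h2 := abs_sub_le_travelTime hb.measurable hl h z y
  refine h2.trans (mul_le_mul_of_nonneg_left ?_ hu.le)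
  -- Both feet lie a time `t` before `x`, each for its own velocity. Their gap in `b`-time is thus
  -- the discrepancy of the two travel times over the same stretch from `y` to `x`.
  have h3 : travelTime b y - travelTime b z
      = (travelTime c x - travelTime c y) - (travelTime b x - travelTime b y) := by
    rw [hAy, hAz]; ring
  rw [h3]
  refine h1.trans (mul_le_mul_of_nonneg_left (abs_sub_position_le hc hl h' ht x) ?_)
  exact div_nonneg ((abs_nonneg _).trans (hη 0)) (by positivity)

end Transport

theorem isRegularizationLimit_transport {L T l u : ℝ} {ρ a w₀ : ℝ → ℝ} {α γ K M : ℝ≥0}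
    (hl : 0 < l) (hα : 0 < α) (hγ : 0 < γ) (hap : Function.Periodic a L)
    (h : ∀ x, l ≤ a x ∧ a x ≤ u) (ha : HolderWith K α a) (hwp : Function.Periodic w₀ L)
    (hw : HolderWith M γ w₀) (hρ : IsMollifier ρ) :
    IsRegularizationLimit L T ρ a w₀ (transport a w₀) := by
  have hac := ha.continuous hα
  have hwc := hw.continuous hγ
  have hu : 0 < u := hl.trans_le ((h 0).1.trans (h 0).2)
  have hm : ∀ {δ}, 0 < δ → ∀ x, l ≤ mollify ρ δ a x ∧ mollify ρ δ a x ≤ u := fun hδ x =>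
    mollify_mem_Icc hρ hδ hac fun y _ => h _
  constructor
  · intro δ hδ
    exact ⟨_, isClassicalSolution_transport (contDiff_mollify hρ hδ hac).continuous hl (hm hδ)
      (mollify_periodic hap) ((contDiff_mollify hρ hδ hwc).of_le (by exact_mod_cast le_top))
      (mollify_periodic hwp)⟩
  · intro v hv
    -- The first term is the shift of the foot caused by mollifying `a`, seen through the modulus of
    -- `w₀`; the second is the error of mollifying `w₀`.
    set E : ℝ → ℝ := fun δ => M * (u * (K * δ ^ (α : ℝ) / l ^ 2 * (u * T))) ^ (γ : ℝ)
      + M * δ ^ (γ : ℝ)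
    have hE : Tendsto E (𝓝[>] 0) (𝓝 0) := by
      have h1 : ∀ {r : ℝ≥0}, 0 < r → Tendsto (fun δ : ℝ => δ ^ (r : ℝ)) (𝓝[>] 0) (𝓝 0) := by
        intro r hr
        have := (Real.continuous_rpow_const (q := r) r.2).tendsto 0
        rw [Real.zero_rpow (NNReal.coe_pos.2 hr).ne'] at this
        exact this.mono_left nhdsWithin_le_nhds
      have h2 := (((((h1 hα).const_mul (K : ℝ)).div_const (l ^ 2)).mul_const (u * T)).const_mul
        u).rpow_const (p := (γ : ℝ)) (Or.inr γ.2)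
      have h3 := (h2.const_mul (M : ℝ)).add ((h1 hγ).const_mul (M : ℝ))
      simpa [Real.zero_rpow (NNReal.coe_pos.2 hγ).ne'] using h3
    rw [Metric.tendstoUniformlyOn_iff]
    intro ε hε
    filter_upwards [hE.eventually (gt_mem_nhds hε), self_mem_nhdsWithin] with δ hδE hδ p hp
    have hδ : 0 < δ := hδ
    obtain ⟨t, x⟩ := p
    have ht : t ∈ Icc 0 T := hp.1
    refine lt_of_le_of_lt ?_ hδE
    simp only [Function.uncurry]
    have hη := abs_mollify_sub_le hρ hδ hα ha
    have hac' := (contDiff_mollify hρ hδ hac).continuous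
    rw [(hv δ hδ).eq_transport hac' hl (hm hδ) ht, Real.dist_eq, transport, transport]
    refine (abs_sub_le _ (w₀ (position (mollify ρ δ a) (travelTime (mollify ρ δ a) x - t)))
      _).trans (add_le_add ?_ (abs_mollify_sub_le hρ hδ hγ hw _))
    refine holderWith_abs_sub_le hw ?_
    rw [abs_sub_comm]
    refine (abs_position_sub_position_le hac hac' hl h (hm hδ) hη ht.1 x).trans ?_
    have := ht.2
    gcongr

/-! ### Weak solutions -/

theorem exists_holderWith_transport {l u : ℝ} {a w₀ : ℝ → ℝ} {γ M : ℝ≥0} (ha : Continuous a)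
    (hl : 0 < l) (h : ∀ x, l ≤ a x ∧ a x ≤ u) (hw : HolderWith M γ w₀) :
    ∃ H : ℝ≥0, HolderWith H γ (Function.uncurry (transport a w₀)) := by
  have hu : 0 < u := hl.trans_le ((h 0).1.trans (h 0).2)
  have hA : LipschitzWith (1 / l).toNNReal (travelTime a) := LipschitzWith.of_dist_le_mul
    fun y x => by
      rw [Real.dist_eq, Real.dist_eq, Real.coe_toNNReal _ (by positivity), one_div_mul_eq_div]
      exact abs_travelTime_sub_le ha.measurable hl (fun x => (h x).1) x y
  have hB : LipschitzWith u.toNNReal (position a) := LipschitzWith.of_dist_le_mul fun z y => by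
    simpa [Real.dist_eq, Real.coe_toNNReal u hu.le] using abs_position_sub_le ha hl h y z
  have := hw.comp (hB.comp ((hA.comp LipschitzWith.prod_snd).sub
    LipschitzWith.prod_fst)).holderWith
  exact ⟨_, mul_one γ ▸ this⟩

/-- The weak formulation for continuous data, tested with `C¹` functions. -/
theorem transport_weak {L l u : ℝ} {a w₀ : ℝ → ℝ} {φ : ℝ → ℝ → ℝ}
    (ha : Continuous a) (hl : 0 < l) (h : ∀ x, l ≤ a x ∧ a x ≤ u) (hap : Function.Periodic a L)
    (hw : Continuous w₀) (hwp : Function.Periodic w₀ L)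
    (hφ : ContDiff ℝ 1 (Function.uncurry φ)) (hφp : ∀ t, Function.Periodic (φ t) L) (t : ℝ) :
    (∫ s in 0..t, ∫ x in 0..L, transport a w₀ s x / a x * deriv (fun r => φ r x) s)
      + (∫ s in 0..t, ∫ x in 0..L, transport a w₀ s x * deriv (fun y => φ s y) x)
      + (∫ x in 0..L, w₀ x / a x * φ 0 x)
      = ∫ x in 0..L, transport a w₀ t x / a x * φ t x := by
  have hane : ∀ x, a x ≠ 0 := fun x => (hl.trans_le (h x).1).ne'
  have hBc := continuous_position ha hl h
  have hWc := continuous_transport ha hl h hw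
  set F := fderiv ℝ (Function.uncurry φ) with hF
  have hFc : Continuous F := hφ.continuous_fderiv one_ne_zero
  have hd : ∀ p, HasFDerivAt (Function.uncurry φ) (F p) p := fun p =>
    (hφ.differentiable one_ne_zero).differentiableAt.hasFDerivAt
  have h1 : ∀ s x, deriv (fun r => φ r x) s = F (s, x) (1, 0) := fun s x =>
    (HasFDerivAt.comp_hasDerivAt (f := fun r => (r, x)) s (hd (s, x))
      ((hasDerivAt_id s).prodMk (hasDerivAt_const s x))).deriv
  have h2 : ∀ s x, deriv (fun y => φ s y) x = F (s, x) (0, 1) := fun s x =>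
    (HasFDerivAt.comp_hasDerivAt (f := fun y => (s, y)) x (hd (s, x))
      ((hasDerivAt_const x s).prodMk (hasDerivAt_id x))).deriv
  have hp1 : ∀ s x, F (s, x + L) (1, 0) = F (s, x) (1, 0) := fun s x => by
    simp only [← h1, hφp _ x]
  have hp2 : ∀ s x, F (s, x + L) (0, 1) = F (s, x) (0, 1) := fun s x => by
    rw [← h2, ← h2, ← deriv_comp_add_const]
    simp only [hφp s _]
  have h3 : ∀ z s, HasDerivAt (fun r => φ r (position a (z + r)))
      (F (s, position a (z + s)) (1, 0)
        + a (position a (z + s)) * F (s, position a (z + s)) (0, 1)) s := fun z s => by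
    have := HasFDerivAt.comp_hasDerivAt (f := fun r => (r, position a (z + r))) s (hd _)
      ((hasDerivAt_id s).prodMk ((hasDerivAt_position ha hl h (z + s)).comp_const_add z s))
    have hlin : ∀ (p : ℝ × ℝ) (r : ℝ), F p (1, r) = F p (1, 0) + r * F p (0, 1) := fun p r => by
      rw [← smul_eq_mul, ← map_smul, ← map_add]
      simp
    rw [hlin] at this
    exact this
  have c1 : Continuous fun p : ℝ × ℝ => transport a w₀ p.1 p.2 / a p.2 * F p (1, 0) :=
    (hWc.div (ha.comp continuous_snd) fun p => hane _).mul (hFc.clm_apply continuous_const)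
  have c2 : Continuous fun p : ℝ × ℝ => transport a w₀ p.1 p.2 * F p (0, 1) :=
    hWc.mul (hFc.clm_apply continuous_const)
  -- In the variable `z` the factor from `w` no longer depends on `s`, and the two integrands
  -- combine into the derivative of `φ` along a characteristic.
  have hinner : ∀ s, (∫ x in 0..L, transport a w₀ s x / a x * F (s, x) (1, 0))
      + (∫ x in 0..L, transport a w₀ s x * F (s, x) (0, 1))
      = ∫ z in 0..travelTime a L, w₀ (position a z) * (F (s, position a (z + s)) (1, 0)
        + a (position a (z + s)) * F (s, position a (z + s)) (0, 1)) := fun s => by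
    have cs : Continuous fun x : ℝ => (s, x) := by fun_prop
    have i1 := (c1.comp cs).intervalIntegrable (μ := volume) 0 L
    have i2 := (c2.comp cs).intervalIntegrable (μ := volume) 0 L
    simp only [Function.comp_def] at i1 i2
    rw [← intervalIntegral.integral_add i1 i2]
    have := integral_div_eq_integral_position (G := fun x => transport a w₀ s x *
      (F (s, x) (1, 0) + a x * F (s, x) (0, 1))) ha hl h hap
      ((hWc.comp cs).mul (((hFc.comp cs).clm_apply continuous_const).add
        (ha.mul ((hFc.comp cs).clm_apply continuous_const))))
      (fun x => by simp only [transport_periodic ha hl h hap hwp s x, hp1, hp2, hap x]) s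
    simp only [transport_position ha hl h] at this
    rw [← this]
    refine intervalIntegral.integral_congr fun x _ => ?_
    have := hane x
    field_simp
  have cD : Continuous fun p : ℝ × ℝ => w₀ (position a p.2) *
      (F (p.1, position a (p.2 + p.1)) (1, 0)
        + a (position a (p.2 + p.1)) * F (p.1, position a (p.2 + p.1)) (0, 1)) := by
    fun_prop
  have hend : ∀ s, ∫ x in 0..L, transport a w₀ s x / a x * φ s x
      = ∫ z in 0..travelTime a L, w₀ (position a z) * φ s (position a (z + s)) := fun s => by
    have cs : Continuous fun x : ℝ => (s, x) := by fun_prop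
    have := integral_div_eq_integral_position (G := fun x => transport a w₀ s x * φ s x)
      ha hl h hap ((hWc.comp cs).mul (hφ.continuous.comp cs))
      (fun x => by simp only [transport_periodic ha hl h hap hwp s x, hφp s x]) s
    simp only [transport_position ha hl h] at this
    rw [← this]
    exact intervalIntegral.integral_congr fun x _ => div_mul_eq_mul_div _ _ _
  have cend : ∀ s, Continuous fun z => w₀ (position a z) * φ s (position a (z + s)) := fun s =>
    (hw.comp hBc).mul (hφ.continuous.comp
      (continuous_const.prodMk (hBc.comp (continuous_id.add continuous_const))))
  have hstart : ∫ x in 0..L, w₀ x / a x * φ 0 x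
      = ∫ z in 0..travelTime a L, w₀ (position a z) * φ 0 (position a (z + 0)) := by
    rw [← hend]
    simp only [transport_zero ha hl h]
  simp only [h1, h2]
  rw [← intervalIntegral.integral_add
    ((intervalIntegral.continuous_parametric_intervalIntegral_of_continuous' c1 0
      L).intervalIntegrable _ _)
    ((intervalIntegral.continuous_parametric_intervalIntegral_of_continuous' c2 0
      L).intervalIntegrable _ _)]
  simp only [hinner]
  -- Once the time integral is innermost, it is the integral of an exact derivative for each fixed
  -- `z`.
  rw [intervalIntegral_intervalIntegral_swap (F := fun s z => w₀ (position a z) *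
      (F (s, position a (z + s)) (1, 0)
        + a (position a (z + s)) * F (s, position a (z + s)) (0, 1)))
    (cD.continuousOn.integrableOn_compact (isCompact_uIcc.prod isCompact_uIcc) |>.mono_set
      (prod_mono uIoc_subset_uIcc uIoc_subset_uIcc)), hend t, hstart,
    ← intervalIntegral.integral_add ?_ ((cend 0).intervalIntegrable _ _)]
  · refine intervalIntegral.integral_congr fun z _ => ?_
    rw [intervalIntegral.integral_const_mul, intervalIntegral.integral_eq_sub_of_hasDerivAt
      (fun s _ => h3 z s)]
    · ring
    · exact Continuous.intervalIntegrable (by fun_prop) _ _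
  · refine (intervalIntegral.continuous_parametric_intervalIntegral_of_continuous'
      (f := fun z s => w₀ (position a z) * (F (s, position a (z + s)) (1, 0)
        + a (position a (z + s)) * F (s, position a (z + s)) (0, 1)))
      (cD.comp continuous_swap) 0 t).intervalIntegrable _ _

theorem isWeakSolution_transport {L T l u : ℝ} {a w₀ : ℝ → ℝ} {γ M : ℝ≥0}
    (hl : 0 < l) (hγ : 0 < γ) (ha : Continuous a) (hap : Function.Periodic a L)
    (h : ∀ x, l ≤ a x ∧ a x ≤ u) (hwp : Function.Periodic w₀ L) (hw : HolderWith M γ w₀) :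
    IsWeakSolution L T a w₀ (transport a w₀) where
  periodic t _ := transport_periodic ha hl h hap hwp t
  holder := by
    obtain ⟨H, hH⟩ := exists_holderWith_transport ha hl h hw
    exact ⟨γ, hγ, H, hH.holderOnWith _⟩
  weak φ hφ hφp t _ := transport_weak ha hl h hap (hw.continuous hγ) hwp
    (hφ.of_le (by exact_mod_cast le_top)) hφp t

/-! ### Cell averages -/

section CellAverage

variable {f : ℝ → ℝ} {h : ℝ}

theorem cellAverage_mem_Icc (hf : Continuous f) (hh : 0 < h) {l u : ℝ} {j : ℤ}
    (hlu : ∀ x ∈ Icc (((j : ℝ) - 1) * h) (j * h), f x ∈ Icc l u) : cellAverage h f j ∈ Icc l u := by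
  have hle : ((j : ℝ) - 1) * h ≤ j * h := by nlinarith
  have h1 := intervalIntegral.integral_mono_on hle (intervalIntegrable_const (c := l))
    (hf.intervalIntegrable (μ := volume) _ _) fun x hx => (hlu x hx).1
  have h2 := intervalIntegral.integral_mono_on hle (hf.intervalIntegrable (μ := volume) _ _)
    (intervalIntegrable_const (c := u)) fun x hx => (hlu x hx).2
  rw [intervalIntegral.integral_const, smul_eq_mul] at h1 h2
  rw [cellAverage, one_div_mul_eq_div]
  constructor
  · rw [le_div_iff₀ hh]; linarith
  · rw [div_le_iff₀ hh]; linarith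

theorem abs_cellAverage_sub_le (hf : Continuous f) (hh : 0 < h) {c d : ℝ} {j : ℤ}
    (hd : ∀ x ∈ Icc (((j : ℝ) - 1) * h) (j * h), |f x - c| ≤ d) : |cellAverage h f j - c| ≤ d := by
  have := cellAverage_mem_Icc hf hh (l := c - d) (u := c + d) fun x hx => by
    have := abs_le.1 (hd x hx)
    constructor <;> linarith [this.1, this.2]
  rw [abs_le]
  constructor <;> linarith [this.1, this.2]

/-- The piecewise constant function whose values are the cell averages of `f`. -/
noncomputable def cellStep (h : ℝ) (f : ℝ → ℝ) (x : ℝ) : ℝ := cellAverage h f (⌊x / h⌋ + 1)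

theorem measurable_cellStep : Measurable (cellStep h f) :=
  (Measurable.of_discrete (f := fun i : ℤ => cellAverage h f (i + 1))).comp
    (Int.measurable_floor.comp (measurable_id.div_const h))

theorem mem_cell (hh : 0 < h) (x : ℝ) :
    x ∈ Icc ((((⌊x / h⌋ + 1 : ℤ) : ℝ) - 1) * h) ((⌊x / h⌋ + 1 : ℤ) * h) := by
  push_cast
  rw [add_sub_cancel_right]
  exact ⟨(le_div_iff₀ hh).1 (Int.floor_le _), ((div_lt_iff₀ hh).1 (Int.lt_floor_add_one _)).le⟩

theorem abs_sub_cellStep_le {K α : ℝ≥0} (hα : 0 < α) (hf : HolderWith K α f) (hh : 0 < h) (x : ℝ) :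
    |f x - cellStep h f x| ≤ K * h ^ (α : ℝ) := by
  rw [abs_sub_comm]
  refine abs_cellAverage_sub_le (hf.continuous hα) hh fun y hy => holderWith_abs_sub_le hf ?_
  have hx := mem_cell hh x
  rw [abs_le]
  constructor <;> linarith [hx.1, hx.2, hy.1, hy.2]

/-- The velocity is constant inside a cell. This identifies the jump length of the scheme with an
increment of a genuine travel time. -/
theorem travelTime_cellStep_sub {l : ℝ} (hl : 0 < l) (hlf : ∀ x, l ≤ cellStep h f x)
    (hh : 0 < h) (j : ℤ) :
    travelTime (cellStep h f) (j * h) - travelTime (cellStep h f) ((j - 1 : ℤ) * h)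
      = h / cellAverage h f j := by
  rw [travelTime_sub measurable_cellStep hl hlf]
  have hle : ((j - 1 : ℤ) : ℝ) * h ≤ j * h := by push_cast; nlinarith
  -- The open interval is needed: at the right endpoint `cellStep` already has the value of the next
  -- cell.
  rw [intervalIntegral.integral_congr_Ioo_of_le hle (g := fun _ => 1 / cellAverage h f j)]
  · rw [intervalIntegral.integral_const, smul_eq_mul]
    push_cast
    ring
  · intro x hx
    have : ⌊x / h⌋ = j - 1 := by
      rw [Int.floor_eq_iff, le_div_iff₀ hh, div_lt_iff₀ hh]
      refine ⟨hx.1.le, ?_⟩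
      push_cast
      linarith [hx.2]
    simp only [cellStep, this, sub_add_cancel]

end CellAverage

/-! ### The upwind scheme -/

/-- A quadratic bound on the initial data in terms of the discrete travel time `τ` propagates
along the scheme, up to a numerical diffusion of variance `k h / l` in every time step. -/
theorem abs_upwindScheme_sub_le {h k l : ℝ} {a w₀ : ℝ → ℝ} {τ : ℤ → ℝ} {c P Q σ : ℝ}
    (hh : 0 < h) (hk : 0 < k) (hl : 0 < l) (ha : ∀ j, l ≤ cellAverage h a j)
    (hcfl : ∀ j, k / h * cellAverage h a j ≤ 1) (hτ : ∀ j, τ j - τ (j - 1) = h / cellAverage h a j)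
    (hQ : 0 ≤ Q) (h0 : ∀ j, |cellAverage h w₀ j - c| ≤ P + Q * (τ j - σ) ^ 2) (n : ℕ) (j : ℤ) :
    |upwindScheme h k a w₀ n j - c| ≤ P + Q * ((τ j - n * k - σ) ^ 2 + n * (k * h / l)) := by
  induction n generalizing j with
  | zero => simpa [upwindScheme] using h0 j
  | succ n ih =>
    set A := cellAverage h a j with hA
    have hApos : 0 < A := hl.trans_le (ha j)
    set r := k / h * A with hr
    have hr0 : 0 ≤ r := by positivity
    have hr1 : r ≤ 1 := hcfl j
    -- A convex combination, since the CFL condition gives `0 ≤ r ≤ 1`.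
    have e : upwindScheme h k a w₀ (n + 1) j - c
        = (1 - r) * (upwindScheme h k a w₀ n j - c)
          + r * (upwindScheme h k a w₀ n (j - 1) - c) := by
      rw [upwindScheme]; ring
    have hτ' : τ (j - 1) = τ j - h / A := by rw [← hτ j]; ring
    have i2 := ih (j - 1)
    rw [hτ'] at i2
    rw [e]
    refine (abs_add_le _ _).trans ?_
    rw [abs_mul, abs_mul, abs_of_nonneg hr0, abs_of_nonneg (sub_nonneg.2 hr1)]
    refine (add_le_add (mul_le_mul_of_nonneg_left (ih j) (sub_nonneg.2 hr1))
      (mul_le_mul_of_nonneg_left i2 hr0)).trans ?_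
    have hvar : k * h / A ≤ k * h / l :=
      div_le_div_of_nonneg_left (by positivity) hl (ha j)
    -- The mean displacement in travel time is `k` in every cell, so variable velocity causes no
    -- drift error.
    have hmean : r * (h / A) = k := by rw [hr]; field_simp
    have hsq : r * (h / A) ^ 2 = k * h / A := by rw [hr]; field_simp
    have key : (1 - r) * (τ j - n * k - σ) ^ 2 + r * (τ j - h / A - n * k - σ) ^ 2
        ≤ (τ j - (n + 1) * k - σ) ^ 2 + k * h / l := by
      have : (1 - r) * (τ j - n * k - σ) ^ 2 + r * (τ j - h / A - n * k - σ) ^ 2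
          = (τ j - n * k - σ) ^ 2 - 2 * (r * (h / A)) * (τ j - n * k - σ)
            + r * (h / A) ^ 2 := by ring
      rw [this, hmean, hsq]
      -- The exact variance is `k h / A - k²`; the term `-k²` is discarded.
      nlinarith [sq_nonneg k]
    push_cast
    have := mul_le_mul_of_nonneg_left key hQ
    linear_combination this

/-- Second moments are what the scheme propagates, so the Hölder modulus is replaced by a quadratic
one: the constant term covers `r ≤ ε`, the quadratic term `r ≥ ε`. -/
theorem rpow_le_rpow_mul_one_add_sq {r ε p : ℝ} (hr : 0 ≤ r) (hε : 0 < ε) (hp : 0 ≤ p)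
    (hp1 : p ≤ 1) :
    r ^ p ≤ ε ^ p * (1 + r ^ 2 / ε ^ 2) := by
  have h1 : r ^ p = ε ^ p * (r / ε) ^ p := by
    rw [← Real.mul_rpow hε.le (by positivity), mul_div_cancel₀ _ hε.ne']
  rw [h1, ← div_pow]
  refine mul_le_mul_of_nonneg_left ?_ (by positivity)
  rcases le_total (r / ε) 1 with h | h
  · have := Real.rpow_le_one (by positivity) h hp
    nlinarith [sq_nonneg (r / ε)]
  · have := Real.rpow_le_rpow_of_exponent_le h (hp1.trans one_le_two)
    rw [Real.rpow_two] at this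
    linarith

/-- The pointwise error of the upwind scheme, with a free length `ε`. -/
theorem abs_transport_sub_approx_le {l u T h k ε t : ℝ} {a w₀ : ℝ → ℝ} {α γ K M : ℝ≥0}
    (hl : 0 < l) (hα : 0 < α) (hγ : 0 < γ) (hγ1 : γ ≤ 1) (hlu : ∀ x, l ≤ a x ∧ a x ≤ u)
    (ha : HolderWith K α a) (hw : HolderWith M γ w₀) (hh : 0 < h) (hk : 0 < k)
    (hcfl : k * u ≤ h) (hε : 0 < ε) (ht : 0 ≤ t) (htT : t ≤ T) (x : ℝ) :
    |transport a w₀ t x - approx h k a w₀ t x| ≤ M * (ε ^ (γ : ℝ) *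
      (1 + 2 * h ^ 2 / ε ^ 2 + 2 * u ^ 2 / ε ^ 2 *
        ((2 * (h / l) + K * h ^ (α : ℝ) / l ^ 2 * (u * T)) ^ 2 + T * h / l))) := by
  have hac := ha.continuous hα
  have hu : 0 < u := hl.trans_le ((hlu 0).1.trans (hlu 0).2)
  have hav : ∀ j, l ≤ cellAverage h a j ∧ cellAverage h a j ≤ u := fun j =>
    cellAverage_mem_Icc hac hh fun x _ => hlu x
  have hstep : ∀ x, l ≤ cellStep h a x ∧ cellStep h a x ≤ u := fun x => hav _
  have hmeas : Measurable (cellStep h a) := measurable_cellStep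
  set y := position a (travelTime a x - t) with hy
  set τ := travelTime (cellStep h a) with hτ
  -- The initial data are compared with their value at the exact foot `y`. The constants `P` and `Q`
  -- of the propagated bound come from `(p + q)² ≤ 2p² + 2q²`.
  have hinit : ∀ j : ℤ, |cellAverage h w₀ j - w₀ y|
      ≤ M * (ε ^ (γ : ℝ) * (1 + 2 * h ^ 2 / ε ^ 2))
        + M * (ε ^ (γ : ℝ) * (2 * u ^ 2 / ε ^ 2)) * (τ (j * h) - τ y) ^ 2 := fun j => by
    set r := h + u * |τ (j * h) - τ y| with hr
    have hr0 : 0 ≤ r := by positivity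
    have h1 : |cellAverage h w₀ j - w₀ y| ≤ M * r ^ (γ : ℝ) := by
      refine abs_cellAverage_sub_le (hw.continuous hγ) hh fun ξ hξ => holderWith_abs_sub_le hw ?_
      have h2 := abs_sub_le_travelTime hmeas hl hstep y (j * h)
      have h3 : |ξ - j * h| ≤ h := by
        rw [abs_le]
        constructor <;> linarith [hξ.1, hξ.2]
      exact (abs_sub_le _ (j * h) _).trans (add_le_add h3 h2)
    have h4 : r ^ 2 ≤ 2 * h ^ 2 + 2 * u ^ 2 * (τ (j * h) - τ y) ^ 2 := by
      rw [← sq_abs (τ (j * h) - τ y)]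
      nlinarith [sq_nonneg (h - u * |τ (j * h) - τ y|)]
    have h5 := rpow_le_rpow_mul_one_add_sq hr0 hε γ.2 (by exact_mod_cast hγ1 : (γ : ℝ) ≤ 1)
    have h6 : r ^ 2 / ε ^ 2 ≤ (2 * h ^ 2 + 2 * u ^ 2 * (τ (j * h) - τ y) ^ 2) / ε ^ 2 :=
      div_le_div_of_nonneg_right h4 (by positivity)
    calc |cellAverage h w₀ j - w₀ y| ≤ M * r ^ (γ : ℝ) := h1
      _ ≤ M * (ε ^ (γ : ℝ) * (1 + (2 * h ^ 2 + 2 * u ^ 2 * (τ (j * h) - τ y) ^ 2) / ε ^ 2)) := by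
        refine mul_le_mul_of_nonneg_left (h5.trans ?_) M.2
        exact mul_le_mul_of_nonneg_left (by linarith) (by positivity)
      _ = _ := by ring
  set n := ⌊t / k⌋₊ with hn
  set j := ⌊x / h⌋ + 1 with hj
  have hmain := abs_upwindScheme_sub_le (τ := fun j : ℤ => τ (j * h)) (a := a) (w₀ := w₀) hh hk hl
    (fun j => (hav j).1)
    (fun j => by
      rw [div_mul_eq_mul_div, div_le_one hh]
      exact (mul_le_mul_of_nonneg_left (hav j).2 hk.le).trans hcfl)
    (travelTime_cellStep_sub hl (fun x => (hstep x).1) hh) (by positivity) hinit n j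
  have hnt : n * k ≤ t := (le_div_iff₀ hk).1 (Nat.floor_le (by positivity))
  have hnt' : t ≤ n * k + k := by
    have := (div_lt_iff₀ hk).1 (Nat.lt_floor_add_one (t / k))
    rw [add_mul, one_mul] at this
    exact this.le
  have hkl : k ≤ h / l := by
    rw [le_div_iff₀ hl]
    exact (mul_le_mul_of_nonneg_left ((hlu 0).1.trans (hlu 0).2) hk.le).trans hcfl
  -- Three errors: `x` versus the cell edge `j h` and `t` versus `n k`, each at most `h / l`, and
  -- the travel time of `cellStep` versus that of `a`, of order `h ^ α`.
  have hdev : |τ (j * h) - n * k - τ y| ≤ 2 * (h / l) + K * h ^ (α : ℝ) / l ^ 2 * (u * T) := by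
    have d1 : |τ (j * h) - τ x| ≤ h / l := by
      refine (abs_travelTime_sub_le hmeas hl (fun x => (hstep x).1) x (j * h)).trans
        (div_le_div_of_nonneg_right ?_ hl.le)
      have := mem_cell hh x
      rw [abs_le]
      constructor <;> linarith [this.1, this.2]
    have d2 : |(τ x - τ y) - (travelTime a x - travelTime a y)|
        ≤ K * h ^ (α : ℝ) / l ^ 2 * (u * T) := by
      refine (abs_travelTime_sub_sub_le hac.measurable hmeas hl (fun x => (hlu x).1)
        (fun x => (hstep x).1) (abs_sub_cellStep_le hα ha hh) y x).trans ?_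
      refine mul_le_mul_of_nonneg_left ?_ (by positivity)
      exact (abs_sub_position_le hac hl hlu ht x).trans (mul_le_mul_of_nonneg_left htT hu.le)
    rw [hy, travelTime_position hac hl hlu, ← hy, sub_sub_cancel] at d2
    rw [abs_le] at d1 d2 ⊢
    constructor <;> linarith [d1.1, d1.2, d2.1, d2.2]
  have hsq := sq_le_sq' (abs_le.1 hdev).1 (abs_le.1 hdev).2
  have hvar : n * (k * h / l) ≤ T * h / l := by
    rw [← mul_div_assoc, ← mul_assoc]
    exact div_le_div_of_nonneg_right (mul_le_mul_of_nonneg_right (hnt.trans htT) hh.le) hl.le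
  rw [abs_sub_comm]
  refine hmain.trans ?_
  refine (add_le_add_right (mul_le_mul_of_nonneg_left (add_le_add hsq hvar) (by positivity))
    _).trans_eq (by ring)

theorem rpow_le_rpow_sub_mul {h L p q : ℝ} (hh : 0 < h) (hL : h ≤ L) (hpq : q ≤ p) :
    h ^ p ≤ L ^ (p - q) * h ^ q := by
  have := Real.rpow_le_rpow hh.le hL (sub_nonneg.2 hpq)
  calc h ^ p = h ^ (p - q) * h ^ q := by rw [← Real.rpow_add hh, sub_add_cancel]
    _ ≤ _ := mul_le_mul_of_nonneg_right this (by positivity)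

/-- The constant in the pointwise error estimate, where `β` is the exponent of the free length. -/
noncomputable def errorConst (L T l u α K β : ℝ) : ℝ :=
  1 + 2 * (L ^ (1 - β)) ^ 2 + 2 * u ^ 2 *
    ((2 * (L ^ (1 - β) / l) + K * L ^ (α - β) / l ^ 2 * (u * T)) ^ 2 + T * L ^ (1 - 2 * β) / l)

theorem one_le_errorConst {L T l u α K β : ℝ} (hL : 0 < L) (hT : 0 < T) (hl : 0 < l) :
    1 ≤ errorConst L T l u α K β := by
  have h1 : 0 ≤ 2 * (L ^ (1 - β)) ^ 2 := by positivity
  have h2 : 0 ≤ 2 * u ^ 2 * ((2 * (L ^ (1 - β) / l) + K * L ^ (α - β) / l ^ 2 * (u * T)) ^ 2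
    + T * L ^ (1 - 2 * β) / l) := by positivity
  rw [errorConst]
  linarith

/-- The upwind scheme converges uniformly with the rate `γ β`, whenever `β ≤ α` and
`β ≤ 1 / 2`. -/
theorem abs_transport_sub_approx_le_rpow {l u T L h k t β : ℝ} {a w₀ : ℝ → ℝ} {α γ K M : ℝ≥0}
    (hl : 0 < l) (hα : 0 < α) (hγ : 0 < γ) (hγ1 : γ ≤ 1) (hlu : ∀ x, l ≤ a x ∧ a x ≤ u)
    (ha : HolderWith K α a) (hw : HolderWith M γ w₀) (hh : 0 < h) (hhL : h ≤ L) (hk : 0 < k)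
    (hcfl : k * u ≤ h) (ht : 0 ≤ t) (htT : t ≤ T) (hβα : β ≤ α) (hβ : 2 * β ≤ 1) (x : ℝ) :
    |transport a w₀ t x - approx h k a w₀ t x|
      ≤ errorConst L T l u α K β * (M * h ^ (γ * β)) := by
  have hu : 0 < u := hl.trans_le ((hlu 0).1.trans (hlu 0).2)
  have hL : 0 < L := hh.trans_le hhL
  have hT : 0 ≤ T := ht.trans htT
  set ε := h ^ β with hε
  have hε0 : 0 < ε := Real.rpow_pos_of_pos hh _
  -- `h` and `h ^ α` are `O(ε)` and `h` is even `O(ε²)`, so every quotient by `ε²` stays bounded.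
  have e1 : h ≤ L ^ (1 - β) * ε := by
    have hβ1 : β ≤ 1 := by
      have : (0 : ℝ) ≤ α := α.2
      linarith
    simpa using rpow_le_rpow_sub_mul hh hhL hβ1
  have e2 : h ^ (α : ℝ) ≤ L ^ (α - β) * ε := rpow_le_rpow_sub_mul hh hhL hβα
  have e3 : h ≤ L ^ (1 - 2 * β) * ε ^ 2 := by
    have := rpow_le_rpow_sub_mul hh hhL hβ
    rwa [Real.rpow_one, mul_comm 2 β, Real.rpow_mul hh.le, Real.rpow_two, mul_comm β 2] at this
  have e4 : ε ^ (γ : ℝ) = h ^ (γ * β) := by rw [hε, ← Real.rpow_mul hh.le, mul_comm]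
  refine (abs_transport_sub_approx_le hl hα hγ hγ1 hlu ha hw hh hk hcfl hε0 ht htT x).trans ?_
  rw [e4, mul_comm (errorConst _ _ _ _ _ _ _), mul_assoc]
  refine mul_le_mul_of_nonneg_left (mul_le_mul_of_nonneg_left ?_ (by positivity)) M.2
  calc 1 + 2 * h ^ 2 / ε ^ 2 + 2 * u ^ 2 / ε ^ 2 *
        ((2 * (h / l) + K * h ^ (α : ℝ) / l ^ 2 * (u * T)) ^ 2 + T * h / l)
      ≤ 1 + 2 * (L ^ (1 - β) * ε) ^ 2 / ε ^ 2 + 2 * u ^ 2 / ε ^ 2 *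
        ((2 * (L ^ (1 - β) * ε / l) + K * (L ^ (α - β) * ε) / l ^ 2 * (u * T)) ^ 2
          + T * (L ^ (1 - 2 * β) * ε ^ 2) / l) := by gcongr
    _ = errorConst L T l u α K β := by
      rw [errorConst]
      field_simp

end Upwind

/-! ### Choice of the exponent, and the bound in `L¹` -/

theorem theorem2p4 (L T ua oa : ℝ) (α γ K : ℝ≥0)
    (hL : 0 < L) (hT : 0 < T) (hua : 0 < ua)
    (hα : 0 < α) (hα1 : α ≤ 1) (hγ : 0 < γ) (hγ1 : γ ≤ 1) :
    ∃ C : ℝ, 0 < C ∧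
      ∀ (a w₀ ρ : ℝ → ℝ) (M : ℝ≥0),
        Function.Periodic a L → (∀ x, ua ≤ a x ∧ a x ≤ oa) → HolderWith K α a →
        Function.Periodic w₀ L → HolderWith M γ w₀ →
        Upwind.IsMollifier ρ →
        ∃ w : ℝ → ℝ → ℝ,
          Upwind.IsRegularizationLimit L T ρ a w₀ w ∧
          Upwind.IsWeakSolution L T a w₀ w ∧
          ∀ θ : ℝ, 0 < θ → θ ≤ 1 / oa → ∀ t ∈ Set.Ioo 0 T,
            (∀ N : ℕ, 0 < N →
              (∫ x in 0..L, |w t x - Upwind.approx (L / N) (θ * (L / N)) a w₀ t x|)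
                ≤ C * M * (L / N) ^ ((γ * α : ℝ) / (γ * α + 2 - γ))
                  + C * ∫ x in 0..L,
                      |w₀ x - Upwind.approx (L / N) (θ * (L / N)) a w₀ 0 x|) ∧
            Filter.Tendsto
              (fun N : ℕ =>
                ∫ x in 0..L, |w t x - Upwind.approx (L / N) (θ * (L / N)) a w₀ t x|)
              Filter.atTop (nhds 0) := by
  set β : ℝ := α / (γ * α + 2 - γ) with hβ
  have hα' : (0 : ℝ) < α := hα
  have hγ' : (0 : ℝ) < γ := hγ
  have hα1' : (α : ℝ) ≤ 1 := hα1
  have hγ1' : (γ : ℝ) ≤ 1 := hγ1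
  have hden : 1 ≤ (γ * α + 2 - γ : ℝ) := by nlinarith
  have hβ0 : 0 < β := div_pos hα' (by linarith)
  have hβα : β ≤ α := div_le_self hα'.le hden
  -- After clearing the denominator this is `(1 - α)(2 - γ) ≥ 0`.
  have hβ2 : 2 * β ≤ 1 := by
    rw [hβ, ← mul_div_assoc, div_le_one (by linarith)]
    nlinarith [mul_nonneg (sub_nonneg.2 hα1') (by linarith : (0 : ℝ) ≤ 2 - γ)]
  set C₀ := Upwind.errorConst L T ua oa α K β
  have hC₀ : 1 ≤ C₀ := Upwind.one_le_errorConst hL hT hua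
  -- The factor `L` comes from integrating a uniform bound over a period. The initial error is not
  -- needed for the estimate; it is added at the end as a nonnegative term.
  have hC : 0 < C₀ * L := by positivity
  refine ⟨C₀ * L, hC, fun a w₀ ρ M hap hlu ha hwp hw hρ => ⟨Upwind.transport a w₀,
    Upwind.isRegularizationLimit_transport hua hα hγ hap hlu ha hwp hw hρ,
    Upwind.isWeakSolution_transport hua hγ (ha.continuous hα) hap hlu hwp hw,
    fun θ hθ hθa t ht => ?_⟩⟩
  have hoa : 0 < oa := hua.trans_le ((hlu 0).1.trans (hlu 0).2)
  rw [mul_div_assoc, ← hβ]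
  have hbound : ∀ N : ℕ, 0 < N →
      (∫ x in 0..L, |Upwind.transport a w₀ t x
        - Upwind.approx (L / N) (θ * (L / N)) a w₀ t x|)
        ≤ C₀ * L * M * (L / N) ^ (γ * β) := fun N hN => by
    have hN' : (1 : ℝ) ≤ N := by exact_mod_cast hN
    have hh : 0 < L / N := by positivity
    have hcfl : θ * (L / N) * oa ≤ L / N := by
      have := (le_div_iff₀ hoa).1 hθa
      nlinarith
    have := intervalIntegral.norm_integral_le_of_norm_le_const (a := 0) (b := L)
      (f := fun x => |Upwind.transport a w₀ t x
        - Upwind.approx (L / N) (θ * (L / N)) a w₀ t x|)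
      (C := C₀ * (M * (L / N) ^ (γ * β))) fun x _ => by
        rw [Real.norm_eq_abs, abs_abs]
        exact Upwind.abs_transport_sub_approx_le_rpow hua hα hγ hγ1 hlu ha hw hh
          (div_le_self hL.le hN') (by positivity) hcfl ht.1.le ht.2.le hβα hβ2 x
    rw [sub_zero, abs_of_pos hL] at this
    refine (le_abs_self _).trans (this.trans_eq (by ring))
  refine ⟨fun N hN => (hbound N hN).trans (le_add_of_nonneg_right (mul_nonneg hC.le
    (intervalIntegral.integral_nonneg hL.le fun _ _ => abs_nonneg _))), ?_⟩
  have hlim : Filter.Tendsto (fun N : ℕ => C₀ * L * M * (L / N) ^ (γ * β)) Filter.atTop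
      (nhds 0) := by
    have := ((tendsto_const_div_atTop_nhds_zero_nat L).rpow_const (p := γ * β)
      (Or.inr (by positivity))).const_mul (C₀ * L * M)
    rwa [Real.zero_rpow (by positivity), mul_zero] at this
  refine squeeze_zero' (Filter.Eventually.of_forall fun N =>
    intervalIntegral.integral_nonneg hL.le fun _ _ => abs_nonneg _) ?_ hlim
  filter_upwards [Filter.eventually_gt_atTop 0] with N hN using hbound N hN
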